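/- **Corollary 3.3 (Hilbert function).** Let $k$ be a field, let $m_0<m_1<m_2<m_3$ be positive integers with $\gcd(m_0,m_1,m_2,m_3)=1$ that form an arithmetic progression, $m_j=m_0+jd$ with common difference $d\ge 1$, and write $m_0=3a+b$ with integers $a\ge 1$ and $b\in\{1,2,3\}$. Let $A=k[[t^{m_0},t^{m_1},t^{m_2},t^{m_3}]]$ with maximal ideal $\mathfrak m=(t^{m_0},t^{m_1},t^{m_2},t^{m_3})$, let $G=\operatorname{gr}_{\mathfrak m}(A)=\bigoplus_{i\ge 0}\mathfrak m^i/\mathfrak m^{i+1}$ be its associated graded ring (the coordinate ring of the tangent cone at the origin of the monomial curve $x_j=t^{m_j}$, $0\le j\le 3$), and let $H_G(i)=\dim_k \mathfrak m^i/\mathfrak m^{i+1}$. Then $H_G(i)$ is finite for every integer $i\ge 0$, and, with the convention $\binom{n}{3}=0$ for all integers $n<3$ (including negative $n$): - if $b=1$, $$H_G(i)=\binom{i+3}{3}-3\binom{i+1}{3}-3\binom{i-a+2}{3}+2\binom{i}{3}+6\binom{i-a+1}{3}-3\binom{i-a}{3};$$ - if $b=2$, $$H_G(i)=\binom{i+3}{3}-3\binom{i+1}{3}-2\binom{i-a+2}{3}+2\binom{i}{3}+3\binom{i-a+1}{3}-\binom{i-a-1}{3};$$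 - if $b=3$, $$H_G(i)=\binom{i+3}{3}-3\binom{i+1}{3}-\binom{i-a+2}{3}+2\binom{i}{3}+3\binom{i-a}{3}-2\binom{i-a-1}{3}.$$ -/

import Mathlib

/-- The numerical semigroup `⟨m₀, m₁, m₂, m₃⟩ = ∑ ℕ mⱼ` generated by the exponents `m`. -/
def expSemigroup (m : Fin 4 → ℕ) : AddSubmonoid ℕ :=
  AddSubmonoid.closure (Set.range m)

/-- The power series in `k[[t]]` all of whose exponents lie in the semigroup `⟨m₀, m₁, m₂, m₃⟩`, as a
subalgebra of `k[[t]]`.  For positive exponents these are exactly the power series in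
`t^{m₀}, …, t^{m₃}`, see `mem_curveSubalgebra_iff_exists_subst`. -/
def curveSubalgebra (k : Type*) [Field k] (m : Fin 4 → ℕ) : Subalgebra k (PowerSeries k) where
  carrier := {f | ∀ n, PowerSeries.coeff n f ≠ 0 → n ∈ expSemigroup m}
  mul_mem' := by
    intro f g hf hg n hn
    rw [PowerSeries.coeff_mul] at hn
    obtain ⟨p, hp, hne⟩ := Finset.exists_ne_zero_of_sum_ne_zero hn
    rw [← Finset.HasAntidiagonal.mem_antidiagonal.mp hp]
    exact add_mem (hf _ (left_ne_zero_of_mul hne)) (hg _ (right_ne_zero_of_mul hne))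
  add_mem' := by
    intro f g hf hg n hn
    by_cases h : PowerSeries.coeff n f = 0
    · exact hg n (by simpa [h] using hn)
    · exact hf n h
  algebraMap_mem' := by
    intro r n hn
    have h0 : n = 0 := by
      by_contra h
      exact hn (by rw [PowerSeries.algebraMap_apply, PowerSeries.coeff_C]; simp [h])
    rw [h0]
    exact zero_mem _

/-- The ring `A = k[[t^{m₀}, t^{m₁}, t^{m₂}, t^{m₃}]]`. -/
def CurveRing (k : Type*) [Field k] (m : Fin 4 → ℕ) : Type _ := ↥(curveSubalgebra k m)

noncomputable instance (k : Type*) [Field k] (m : Fin 4 → ℕ) : CommRing (CurveRing k m) :=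
  inferInstanceAs (CommRing ↥(curveSubalgebra k m))

noncomputable instance (k : Type*) [Field k] (m : Fin 4 → ℕ) : Algebra k (CurveRing k m) :=
  inferInstanceAs (Algebra k ↥(curveSubalgebra k m))

/-- The element `t^{mⱼ}` of `A`. -/
noncomputable def curveGen (k : Type*) [Field k] (m : Fin 4 → ℕ) (j : Fin 4) : CurveRing k m :=
  (⟨PowerSeries.X ^ m j, by
    intro n hn
    have h0 : n = m j := by
      by_contra h
      exact hn (by rw [PowerSeries.coeff_X_pow]; simp [h])
    rw [h0]
    exact AddSubmonoid.subset_closure ⟨j, rfl⟩⟩ : ↥(curveSubalgebra k m))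

/-- The ideal `𝔪 = (t^{m₀}, t^{m₁}, t^{m₂}, t^{m₃})` of `A`. -/
noncomputable def curveIdeal (k : Type*) [Field k] (m : Fin 4 → ℕ) : Ideal (CurveRing k m) :=
  Ideal.span (Set.range (curveGen k m))

/-- The `i`-th graded piece `Iⁱ / Iⁱ⁺¹` of the associated graded ring `gr_I(A)`. -/
abbrev gradedPiece {A : Type*} [CommRing A] (I : Ideal A) (i : ℕ) : Type _ :=
  ↥(I ^ i) ⧸ Submodule.submoduleOf (I ^ (i + 1)) (I ^ i)

/-- The Hilbert function `i ↦ dim_k (Iⁱ / Iⁱ⁺¹)` of the associated graded ring `gr_I(A)` of a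
`k`-algebra `A`. -/
noncomputable def hilbertFun (k : Type*) [Field k] {A : Type*} [CommRing A] [Algebra k A]
    (I : Ideal A) (i : ℕ) : ℕ :=
  Module.finrank k (gradedPiece I i)

/-- The binomial coefficient `C(n, 3)` for an integer `n`, equal to `0` for `n < 3`
(in particular for negative `n`). -/
def binom3 (n : ℤ) : ℤ := (n.toNat.choose 3 : ℕ)

/-- Consistency of `curveSubalgebra`: for positive exponents, its elements are exactly the power series
`F(t^{m₀}, t^{m₁}, t^{m₂}, t^{m₃})` with `F ∈ k[[x₀, x₁, x₂, x₃]]`. -/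
theorem mem_curveSubalgebra_iff_exists_subst (k : Type*) [Field k] (m : Fin 4 → ℕ)
    (hm : ∀ j, 0 < m j) (f : PowerSeries k) :
    f ∈ curveSubalgebra k m ↔ ∃ F : MvPowerSeries (Fin 4) k,
      MvPowerSeries.subst (fun j => (PowerSeries.X ^ m j : PowerSeries k)) F = f := by
  have hs : MvPowerSeries.HasSubst (fun j => (PowerSeries.X ^ m j : PowerSeries k)) := by
    apply MvPowerSeries.hasSubst_of_constantCoeff_zero
    intro j
    change PowerSeries.constantCoeff (PowerSeries.X ^ m j : PowerSeries k) = 0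
    simp [(hm j).ne']
  have hp : ∀ d : Fin 4 →₀ ℕ,
      (d.prod fun s e => (PowerSeries.X ^ m s : PowerSeries k) ^ e)
        = PowerSeries.X ^ (∑ s, d s * m s) := by
    intro d
    rw [Finsupp.prod_fintype _ _ (by simp), ← Finset.prod_pow_eq_pow_sum]
    exact Finset.prod_congr rfl fun s _ => by rw [← pow_mul, mul_comm]
  have hc : ∀ (F : MvPowerSeries (Fin 4) k) (n : ℕ),
      PowerSeries.coeff n (MvPowerSeries.subst
        (fun j => (PowerSeries.X ^ m j : PowerSeries k)) F : PowerSeries k)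
        = finsum fun d : Fin 4 →₀ ℕ =>
            MvPowerSeries.coeff d F * (if n = ∑ s, d s * m s then 1 else 0) := by
    intro F n
    have h := MvPowerSeries.coeff_subst hs F (Finsupp.single () n)
    rw [PowerSeries.coeff, h]
    refine finsum_congr fun d => ?_
    rw [hp d, smul_eq_mul, ← PowerSeries.coeff_X_pow]
    rfl
  have hS : ∀ d : Fin 4 →₀ ℕ, ∑ s, d s * m s ∈ expSemigroup m := by
    intro d
    refine sum_mem fun s _ => ?_
    rw [← smul_eq_mul]
    have h : m s ∈ expSemigroup m := AddSubmonoid.subset_closure (Set.mem_range_self s)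
    exact nsmul_mem h _
  have hS' : ∀ n ∈ expSemigroup m, ∃ d : Fin 4 →₀ ℕ, ∑ s, d s * m s = n := by
    intro n hn
    induction hn using AddSubmonoid.closure_induction with
    | mem x hx =>
      obtain ⟨j, rfl⟩ := hx
      exact ⟨Finsupp.single j 1, by simp [Finsupp.single_apply]⟩
    | zero => exact ⟨0, by simp⟩
    | add x y _ _ hx hy =>
      obtain ⟨d, rfl⟩ := hx
      obtain ⟨e, rfl⟩ := hy
      exact ⟨d + e, by simp [add_mul, Finset.sum_add_distrib]⟩
  constructor
  · intro hf
    choose! r hr using hS'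
    obtain ⟨F, hF⟩ : ∃ F : MvPowerSeries (Fin 4) k, ∀ d, MvPowerSeries.coeff d F =
        if r (∑ s, d s * m s) = d then PowerSeries.coeff (∑ s, d s * m s) f else 0 :=
      ⟨fun d => if r (∑ s, d s * m s) = d then
        PowerSeries.coeff (∑ s, d s * m s) f else 0, fun d => rfl⟩
    refine ⟨F, PowerSeries.ext fun n => ?_⟩
    rw [hc]
    by_cases hn : n ∈ expSemigroup m
    · rw [finsum_eq_single _ (r n)]
      · simp [hF, hr n hn]
      · intro d hd
        simp only [hF]
        split_ifs with h1 h2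
        · exact absurd (by rw [h2, h1]) hd
        all_goals simp
    · have h0 : PowerSeries.coeff n f = 0 := by
        by_contra h
        exact hn (hf n h)
      rw [h0]
      apply finsum_eq_zero_of_forall_eq_zero
      intro d
      rw [if_neg, mul_zero]
      rintro rfl
      exact hn (hS d)
  · rintro ⟨F, rfl⟩ n hn
    rw [hc] at hn
    obtain ⟨d, hd⟩ := not_forall.mp (mt finsum_eq_zero_of_forall_eq_zero hn)
    have h := right_ne_zero_of_mul hd
    rw [ne_eq, ite_eq_right_iff, not_forall] at h
    rw [h.1]
    exact hS d

/-! The power `𝔪ⁱ` consists of all series supported on the set `Sᵢ` of sums of at least `i`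
generators (`mem_curveIdeal_pow_iff`), so `𝔪ⁱ / 𝔪ⁱ⁺¹` has as basis the classes of `tⁿ` with `n ∈ Sᵢ
\ Sᵢ₊₁`. These `n` are the `i * m₀ + s * d` with `s ≤ 3i` and `s < m₀`: the relation `m₀ · d = d ·
m₀` trades `m₀` steps `d` for `d` more terms (`mem_arithExponents_succ_or`), and coprimality of `m₀`
and `d` rules out any cheaper trade (`notMem_arithExponents_succ`). Hence `H_G(i) = min (3i + 1)
m₀`, and the three formulas are polynomial identities on the ranges `i ≤ a` and `i > a`. -/

/-- The inclusion of the curve ring into the ring of power series. -/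
noncomputable def curveVal (k : Type*) [Field k] (m : Fin 4 → ℕ) :
    CurveRing k m →ₐ[k] PowerSeries k :=
  (curveSubalgebra k m).val

/-! ### Combinatorics of the exponents. -/

/-- The sums of at least `i` terms of the arithmetic progression `m₀, m₀ + d, m₀ + 2d, m₀ + 3d`. -/
def arithExponents (m₀ d i : ℕ) : Set ℕ :=
  {n | ∃ j s, i ≤ j ∧ s ≤ 3 * j ∧ n = j * m₀ + s * d}

theorem arithExponents_add_mem {m₀ d i i' n n' : ℕ} (h : n ∈ arithExponents m₀ d i)
    (h' : n' ∈ arithExponents m₀ d i') : n + n' ∈ arithExponents m₀ d (i + i') := by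
  obtain ⟨j, s, hj, hs, rfl⟩ := h
  obtain ⟨j', s', hj', hs', rfl⟩ := h'
  exact ⟨j + j', s + s', by omega, by omega, by ring⟩

theorem mem_expSemigroup_iff {m : Fin 4 → ℕ} {d : ℕ}
    (hm : ∀ j : Fin 4, m j = m 0 + (j : ℕ) * d) {n : ℕ} :
    n ∈ expSemigroup m ↔ n ∈ arithExponents (m 0) d 0 := by
  constructor
  · intro hn
    induction hn using AddSubmonoid.closure_induction with
    | mem x hx =>
      obtain ⟨j, rfl⟩ := hx
      exact ⟨1, j, by omega, by omega, by rw [hm j, one_mul]⟩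
    | zero => exact ⟨0, 0, le_rfl, le_rfl, by simp⟩
    | add x y _ _ hx hy => exact arithExponents_add_mem hx hy
  · rintro ⟨j, s, -, hs, rfl⟩
    induction j generalizing s with
    | zero =>
      obtain rfl : s = 0 := by omega
      simp
    | succ j ih =>
      -- Greedy choice: the last generator absorbs as many steps `d` as it can, at most 3.
      have h1 := ih (s - min s 3) (by omega)
      have h2 : m ⟨min s 3, by omega⟩ ∈ expSemigroup m :=
        AddSubmonoid.subset_closure ⟨_, rfl⟩
      rw [hm] at h2
      have h3 := add_mem h1 h2
      have h4 : s = (s - min s 3) + min s 3 := by omega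
      have h5 : (j + 1) * m 0 + s * d
          = j * m 0 + (s - min s 3) * d + (m 0 + min s 3 * d) := by
        conv_lhs => rw [h4]
        ring
      rw [h5]
      exact h3

theorem coprime_of_gcd_eq_one {m : Fin 4 → ℕ} {d : ℕ}
    (hm : ∀ j : Fin 4, m j = m 0 + (j : ℕ) * d) (hgcd : Finset.univ.gcd m = 1) :
    (m 0).Coprime d := by
  refine Nat.dvd_one.mp (hgcd ▸ Finset.dvd_gcd fun j _ => ?_)
  rw [hm j]
  exact dvd_add (Nat.gcd_dvd_left _ _) ((Nat.gcd_dvd_right _ _).mul_left _)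

/-- A second expression with more terms makes `(s - s') * d` a positive multiple of `m₀`, so `m₀ ∣ s
- s'` although `0 < s - s' < m₀`. -/
theorem notMem_arithExponents_succ {m₀ d i s : ℕ} (hcop : m₀.Coprime d)
    (hs : s < m₀) : i * m₀ + s * d ∉ arithExponents m₀ d (i + 1) := by
  rintro ⟨j, s', hj, -, h⟩
  obtain ⟨l, rfl⟩ := Nat.exists_eq_add_of_le hj
  have h1 : s * d = (l + 1) * m₀ + s' * d := by nlinarith
  have h2 : s' < s := by
    by_contra h3
    have := Nat.mul_le_mul_right d (not_lt.mp h3)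
    have : 0 < (l + 1) * m₀ := Nat.mul_pos (by omega) (by omega)
    omega
  obtain ⟨r, rfl⟩ := Nat.exists_eq_add_of_lt h2
  have h3 : m₀ ∣ (r + 1) * d := ⟨l + 1, by nlinarith⟩
  have := Nat.le_of_dvd (by omega) (hcop.dvd_of_dvd_mul_right h3)
  omega

theorem mem_arithExponents_succ_or {m₀ d i n : ℕ} (hd : 0 < d)
    (hn : n ∈ arithExponents m₀ d i) :
    n ∈ arithExponents m₀ d (i + 1) ∨ ∃ s < min (3 * i + 1) m₀, n = i * m₀ + s * d := by
  obtain ⟨j, s, hj, hs, rfl⟩ := hn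
  rcases hj.lt_or_eq with hj | rfl
  · exact Or.inl ⟨j, s, hj, hs, rfl⟩
  · by_cases h : s < m₀
    · exact Or.inr ⟨s, by omega, rfl⟩
    · obtain ⟨r, rfl⟩ := Nat.exists_eq_add_of_le (not_lt.mp h)
      exact Or.inl ⟨i + d, r, Nat.add_le_add_left hd i, by omega, by ring⟩

/-! ### Powers of the maximal ideal as monomial ideals. -/

/-- For `e ∈ T`, all terms of `f` with exponent in `e + S`, where `S` is the semigroup, form a
single multiple `t^e * q`. Removing it leaves a support covered by the rest of `T`; as `T` is
finite, no limit argument is needed. -/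
theorem X_pow_mul_mem_of_support {k : Type*} [Field k] {m : Fin 4 → ℕ} (J : Ideal (CurveRing k m))
    (T : Finset ℕ) (hT : ∀ e ∈ T, ∃ g ∈ J, curveVal k m g = PowerSeries.X ^ e)
    (f : CurveRing k m)
    (hf : ∀ n, PowerSeries.coeff n (curveVal k m f) ≠ 0 →
      ∃ e ∈ T, ∃ t ∈ expSemigroup m, n = e + t) : f ∈ J := by
  classical
  induction T using Finset.induction_on generalizing f with
  | empty =>
    have h0 : f = 0 := by
      apply Subtype.ext
      ext n
      by_contra h
      obtain ⟨e, he, -⟩ := hf n h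
      simp at he
    rw [h0]
    exact J.zero_mem
  | insert e T _ ih =>
    obtain ⟨g, hg, hge⟩ := hT e (Finset.mem_insert_self _ _)
    let q : CurveRing k m := (⟨PowerSeries.mk fun n =>
        if n ∈ expSemigroup m then PowerSeries.coeff (n + e) (curveVal k m f) else 0, by
      intro n hn
      by_contra h
      simp [h] at hn⟩ : ↥(curveSubalgebra k m))
    have hq : curveVal k m q = PowerSeries.mk fun n =>
        if n ∈ expSemigroup m then PowerSeries.coeff (n + e) (curveVal k m f) else 0 := rfl
    have hmem : f - g * q ∈ J := by
      refine ih (fun e' he' => hT e' (Finset.mem_insert_of_mem he')) _ fun n hn => ?_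
      rw [map_sub, map_mul, hge, hq, map_sub, PowerSeries.coeff_X_pow_mul'] at hn
      by_cases h : e ≤ n ∧ n - e ∈ expSemigroup m
      · rw [if_pos h.1, PowerSeries.coeff_mk, if_pos h.2, Nat.sub_add_cancel h.1, sub_self] at hn
        exact absurd rfl hn
      · have hn' : PowerSeries.coeff n (curveVal k m f) ≠ 0 := by
          intro h0
          apply hn
          rw [h0]
          split_ifs with h1
          · rw [PowerSeries.coeff_mk, if_neg fun h2 => h ⟨h1, h2⟩, sub_zero]
          · rw [sub_zero]
        obtain ⟨e', he', t, ht, rfl⟩ := hf n hn'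
        rcases Finset.mem_insert.mp he' with rfl | he'
        · exact absurd ⟨by omega, by simpa using ht⟩ h
        · exact ⟨e', he', t, ht, rfl⟩
    have := J.add_mem hmem (J.mul_mem_right q hg)
    rwa [sub_add_cancel] at this

theorem exists_mem_curveIdeal_pow {k : Type*} [Field k] {m : Fin 4 → ℕ} {d : ℕ}
    (hm : ∀ j : Fin 4, m j = m 0 + (j : ℕ) * d) (i s : ℕ) (hs : s ≤ 3 * i) :
    ∃ g ∈ curveIdeal k m ^ i, curveVal k m g = PowerSeries.X ^ (i * m 0 + s * d) := by
  induction i generalizing s with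
  | zero =>
    obtain rfl : s = 0 := by omega
    exact ⟨1, by simp, by simp⟩
  | succ i ih =>
    obtain ⟨g, hg, hge⟩ := ih (s - min s 3) (by omega)
    refine ⟨g * curveGen k m ⟨min s 3, by omega⟩, ?_, ?_⟩
    · rw [pow_succ]
      exact Ideal.mul_mem_mul hg (Ideal.subset_span ⟨_, rfl⟩)
    · have hv : curveVal k m (curveGen k m ⟨min s 3, by omega⟩)
          = PowerSeries.X ^ m ⟨min s 3, by omega⟩ := rfl
      rw [map_mul, hge, hv, ← pow_add, hm ⟨min s 3, by omega⟩]
      congr 1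
      have h4 : s = (s - min s 3) + min s 3 := by omega
      conv_rhs => rw [h4]
      ring

theorem mem_curveIdeal_pow_iff {k : Type*} [Field k] {m : Fin 4 → ℕ} {d : ℕ}
    (hm : ∀ j : Fin 4, m j = m 0 + (j : ℕ) * d) (i : ℕ) (f : CurveRing k m) :
    f ∈ curveIdeal k m ^ i ↔
      ∀ n, PowerSeries.coeff n (curveVal k m f) ≠ 0 → n ∈ arithExponents (m 0) d i := by
  have hmul : ∀ (p q : ℕ) (f g : CurveRing k m),
      (∀ n, PowerSeries.coeff n (curveVal k m f) ≠ 0 → n ∈ arithExponents (m 0) d p) →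
      (∀ n, PowerSeries.coeff n (curveVal k m g) ≠ 0 → n ∈ arithExponents (m 0) d q) →
      ∀ n, PowerSeries.coeff n (curveVal k m (f * g)) ≠ 0 →
        n ∈ arithExponents (m 0) d (p + q) := by
    intro p q f g hf hg n hn
    rw [map_mul, PowerSeries.coeff_mul] at hn
    obtain ⟨x, hx, hne⟩ := Finset.exists_ne_zero_of_sum_ne_zero hn
    rw [← Finset.HasAntidiagonal.mem_antidiagonal.mp hx]
    exact arithExponents_add_mem (hf _ (left_ne_zero_of_mul hne)) (hg _ (right_ne_zero_of_mul hne))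
  have hring : ∀ (f : CurveRing k m) n, PowerSeries.coeff n (curveVal k m f) ≠ 0 →
      n ∈ arithExponents (m 0) d 0 := fun f n hn => (mem_expSemigroup_iff hm).mp (f.2 n hn)
  have hadd : ∀ (p : ℕ) (f g : CurveRing k m),
      (∀ n, PowerSeries.coeff n (curveVal k m f) ≠ 0 → n ∈ arithExponents (m 0) d p) →
      (∀ n, PowerSeries.coeff n (curveVal k m g) ≠ 0 → n ∈ arithExponents (m 0) d p) →
      ∀ n, PowerSeries.coeff n (curveVal k m (f + g)) ≠ 0 → n ∈ arithExponents (m 0) d p := by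
    intro p f g hf hg n hn
    rw [map_add, map_add] at hn
    by_cases h : PowerSeries.coeff n (curveVal k m f) = 0
    · exact hg n (by simpa [h] using hn)
    · exact hf n h
  have hone : ∀ f ∈ curveIdeal k m, ∀ n, PowerSeries.coeff n (curveVal k m f) ≠ 0 →
      n ∈ arithExponents (m 0) d 1 := by
    intro f hf
    induction hf using Submodule.span_induction with
    | mem x hx =>
      obtain ⟨j, rfl⟩ := hx
      intro n hn
      have hv : curveVal k m (curveGen k m j) = PowerSeries.X ^ m j := rfl
      rw [hv, PowerSeries.coeff_X_pow, ne_eq, ite_eq_right_iff, not_forall] at hn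
      rw [hn.1, hm j]
      exact ⟨1, j, le_rfl, by omega, by rw [one_mul]⟩
    | zero => intro n hn; simp at hn
    | add x y _ _ hx hy => exact hadd 1 x y hx hy
    | smul r x _ hx => simpa using hmul 0 1 r x (hring r) hx
  constructor
  · intro hf
    induction i generalizing f with
    | zero => exact hring f
    | succ i ih =>
      rw [pow_succ] at hf
      refine Submodule.mul_induction_on hf (fun x hx y hy => ?_) (hadd (i + 1))
      exact hmul i 1 x y (ih x hx) (hone y hy)
  · intro hf
    refine X_pow_mul_mem_of_support _
      ((Finset.range (3 * i + 1)).image fun s => i * m 0 + s * d) ?_ f fun n hn => ?_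
    · intro e he
      obtain ⟨s, hs, rfl⟩ := Finset.mem_image.mp he
      exact exists_mem_curveIdeal_pow hm i s (by simpa [Nat.lt_succ_iff] using hs)
    · obtain ⟨j, s, hj, hs, rfl⟩ := hf n hn
      obtain ⟨l, rfl⟩ := Nat.exists_eq_add_of_le hj
      -- The first `i` terms carry at most `3i` steps; the excess fits into the other `l` terms,
      -- whose sum lies in the semigroup.
      have h : s = min s (3 * i) + (s - min s (3 * i)) := by omega
      refine ⟨_, Finset.mem_image.mpr ⟨min s (3 * i), by simp, rfl⟩,
        l * m 0 + (s - min s (3 * i)) * d,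
        (mem_expSemigroup_iff hm).mpr ⟨l, _, by omega, by omega, rfl⟩, ?_⟩
      conv_lhs => rw [h]
      ring

/-! ### Coordinates on the graded pieces. -/

/-- The coefficients at the exponents `i * m₀ + s * d`, `s < N`, of an element of `𝔪ⁱ`. -/
noncomputable def leadingCoeffs (k : Type*) [Field k] (m : Fin 4 → ℕ) (d i N : ℕ) :
    ↥(curveIdeal k m ^ i) →ₗ[k] (Fin N → k) :=
  LinearMap.pi fun s => PowerSeries.coeff (i * m 0 + (s : ℕ) * d) ∘ₗ
    (curveVal k m).toLinearMap ∘ₗ ((curveIdeal k m ^ i).subtype.restrictScalars k)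

theorem leadingCoeffs_apply {k : Type*} [Field k] {m : Fin 4 → ℕ} {d i N : ℕ}
    (f : ↥(curveIdeal k m ^ i)) (s : Fin N) :
    leadingCoeffs k m d i N f s =
      PowerSeries.coeff (i * m 0 + (s : ℕ) * d) (curveVal k m f) := rfl

/-- The bound on `N` keeps the exponents in `Sᵢ`, and `d > 0` keeps them distinct, so coefficients
can be prescribed freely there and set to 0 elsewhere. -/
theorem leadingCoeffs_surjective {k : Type*} [Field k] {m : Fin 4 → ℕ} {d : ℕ} (hd : 0 < d)
    (hm : ∀ j : Fin 4, m j = m 0 + (j : ℕ) * d) (i N : ℕ) (hN : N ≤ 3 * i + 1) :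
    Function.Surjective (leadingCoeffs k m d i N) := by
  intro v
  have hinj : Function.Injective fun s : Fin N => i * m 0 + (s : ℕ) * d := by
    intro s s' h
    exact Fin.ext (Nat.eq_of_mul_eq_mul_right hd (Nat.add_left_cancel h))
  have hsupp : ∀ n, Function.extend (fun s : Fin N => i * m 0 + (s : ℕ) * d) v 0 n ≠ 0 →
      n ∈ arithExponents (m 0) d i := by
    intro n hn
    by_cases h : ∃ s : Fin N, i * m 0 + (s : ℕ) * d = n
    · obtain ⟨s, rfl⟩ := h
      exact ⟨i, s, le_rfl, by omega, rfl⟩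
    · rw [Function.extend_apply' _ _ _ h] at hn
      exact absurd rfl hn
  let f : CurveRing k m := (⟨PowerSeries.mk
      (Function.extend (fun s : Fin N => i * m 0 + (s : ℕ) * d) v 0), by
    intro n hn
    rw [PowerSeries.coeff_mk] at hn
    obtain ⟨j, s, -, hs, rfl⟩ := hsupp n hn
    exact (mem_expSemigroup_iff hm).mpr ⟨j, s, by omega, hs, rfl⟩⟩ : ↥(curveSubalgebra k m))
  have hf : curveVal k m f = PowerSeries.mk
      (Function.extend (fun s : Fin N => i * m 0 + (s : ℕ) * d) v 0) := rfl
  refine ⟨⟨f, (mem_curveIdeal_pow_iff hm i f).mpr fun n hn => hsupp n ?_⟩, ?_⟩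
  · rwa [hf, PowerSeries.coeff_mk] at hn
  · ext s
    rw [leadingCoeffs_apply, hf, PowerSeries.coeff_mk]
    exact hinj.extend_apply v 0 s

theorem ker_leadingCoeffs {k : Type*} [Field k] {m : Fin 4 → ℕ} {d : ℕ} (hd : 0 < d)
    (hm : ∀ j : Fin 4, m j = m 0 + (j : ℕ) * d) (hcop : (m 0).Coprime d) (i : ℕ) :
    LinearMap.ker (leadingCoeffs k m d i (min (3 * i + 1) (m 0))) =
      (Submodule.submoduleOf (curveIdeal k m ^ (i + 1)) (curveIdeal k m ^ i)).restrictScalars k := by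
  ext f
  rw [LinearMap.mem_ker, Submodule.restrictScalars_mem, Submodule.submoduleOf, Submodule.mem_comap,
    Submodule.subtype_apply, mem_curveIdeal_pow_iff hm]
  constructor
  · intro h n hn
    refine (mem_arithExponents_succ_or hd
      ((mem_curveIdeal_pow_iff hm i _).mp f.2 n hn)).resolve_right ?_
    rintro ⟨s, hs, rfl⟩
    exact hn (congrFun h ⟨s, hs⟩)
  · intro h
    ext s
    rw [leadingCoeffs_apply]
    by_contra hne
    exact notMem_arithExponents_succ hcop (lt_of_lt_of_le s.2 (min_le_right _ _)) (h _ hne)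

/-- The graded piece `𝔪ⁱ / 𝔪ⁱ⁺¹` in coordinates. -/
noncomputable def gradedPieceEquiv {k : Type*} [Field k] {m : Fin 4 → ℕ} {d : ℕ} (hd : 0 < d)
    (hm : ∀ j : Fin 4, m j = m 0 + (j : ℕ) * d) (hcop : (m 0).Coprime d) (i : ℕ) :
    gradedPiece (curveIdeal k m) i ≃ₗ[k] (Fin (min (3 * i + 1) (m 0)) → k) :=
  (Submodule.Quotient.restrictScalarsEquiv k _).symm ≪≫ₗ
    Submodule.quotEquivOfEq _ _ (ker_leadingCoeffs hd hm hcop i).symm ≪≫ₗ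
    (leadingCoeffs k m d i _).quotKerEquivOfSurjective
      (leadingCoeffs_surjective hd hm i _ (min_le_left _ _))

theorem hilbertFun_curveIdeal {k : Type*} [Field k] {m : Fin 4 → ℕ} {d : ℕ} (hd : 0 < d)
    (hm : ∀ j : Fin 4, m j = m 0 + (j : ℕ) * d) (hcop : (m 0).Coprime d) (i : ℕ) :
    hilbertFun k (curveIdeal k m) i = min (3 * i + 1) (m 0) := by
  rw [hilbertFun, (gradedPieceEquiv hd hm hcop i).finrank_eq, Module.finrank_fin_fun]

/-! ### Binomial identities and the final formulas. -/

theorem binom3_of_lt {n : ℤ} (hn : n < 3) : binom3 n = 0 := by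
  rw [binom3, Nat.choose_eq_zero_of_lt (by omega), Nat.cast_zero]

theorem six_mul_binom3 {n : ℤ} (hn : 0 ≤ n) : 6 * binom3 n = n * (n - 1) * (n - 2) := by
  obtain ⟨n, rfl⟩ := Int.eq_ofNat_of_zero_le hn
  -- Pascal's rule for `choose 3` involves `choose 2`, so both identities are proved together.
  have hnat : ∀ n : ℕ, 6 * (n.choose 3 : ℤ) = n * (n - 1) * (n - 2) ∧
      2 * (n.choose 2 : ℤ) = n * (n - 1) := by
    intro n
    induction n with
    | zero => simp
    | succ n ih =>
      rw [Nat.choose_succ_succ' n 2, Nat.choose_succ_succ' n 1, Nat.choose_one_right]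
      push_cast
      constructor
      · linear_combination ih.1 + 3 * ih.2
      · linear_combination ih.2
  exact (hnat n).1

/-- Let `m₀ < m₁ < m₂ < m₃` be an arithmetic progression of positive integers with common
difference `d` and `gcd(m₀, m₁, m₂, m₃) = 1`, and write `m₀ = 3a + b` with `a ≥ 1` and
`b ∈ {1, 2, 3}`.  For `A = k[[t^{m₀}, t^{m₁}, t^{m₂}, t^{m₃}]]` with `𝔪 = (t^{m₀}, …, t^{m₃})`, each
`𝔪ⁱ / 𝔪ⁱ⁺¹` is finite-dimensional over `k`, with the dimension `H_G(i)` given below. -/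
theorem corollary3p3 (k : Type*) [Field k] (m : Fin 4 → ℕ) (d a b : ℕ)
    (hd : 0 < d) (hm : ∀ j : Fin 4, m j = m 0 + (j : ℕ) * d)
    (hgcd : Finset.univ.gcd m = 1)
    (ha : 1 ≤ a) (hb : b ∈ Finset.Icc 1 3) (hab : m 0 = 3 * a + b) (i : ℕ) :
    Module.Finite k (gradedPiece (curveIdeal k m) i) ∧
    (b = 1 → (hilbertFun k (curveIdeal k m) i : ℤ) =
      binom3 (i + 3) - 3 * binom3 (i + 1) - 3 * binom3 (i - a + 2) + 2 * binom3 i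
        + 6 * binom3 (i - a + 1) - 3 * binom3 (i - a)) ∧
    (b = 2 → (hilbertFun k (curveIdeal k m) i : ℤ) =
      binom3 (i + 3) - 3 * binom3 (i + 1) - 2 * binom3 (i - a + 2) + 2 * binom3 i
        + 3 * binom3 (i - a + 1) - binom3 (i - a - 1)) ∧
    (b = 3 → (hilbertFun k (curveIdeal k m) i : ℤ) =
      binom3 (i + 3) - 3 * binom3 (i + 1) - binom3 (i - a + 2) + 2 * binom3 i
        + 3 * binom3 (i - a) - 2 * binom3 (i - a - 1)) := by
  have hcop := coprime_of_gcd_eq_one hm hgcd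
  refine ⟨Module.Finite.equiv (gradedPieceEquiv hd hm hcop i).symm, ?_⟩
  rw [hilbertFun_curveIdeal hd hm hcop, hab]
  have h3 := six_mul_binom3 (n := (i : ℤ) + 3) (by omega)
  have h1 := six_mul_binom3 (n := (i : ℤ) + 1) (by omega)
  have h0 := six_mul_binom3 (n := (i : ℤ)) (by omega)
  rcases le_or_gt i a with hia | hia
  -- Here `3i + 1 ≤ 3a + 1 ≤ m₀`, and every binomial involving `a` has argument at most 2, hence
  -- vanishes.
  · have hmin : ∀ c, 1 ≤ c → ((min (3 * i + 1) (3 * a + c) : ℕ) : ℤ) = 3 * i + 1 := by omega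
    rw [hmin b (Finset.mem_Icc.mp hb).1, binom3_of_lt (n := i - a + 2) (by omega),
      binom3_of_lt (n := i - a + 1) (by omega), binom3_of_lt (n := i - a) (by omega),
      binom3_of_lt (n := i - a - 1) (by omega)]
    refine ⟨fun _ => ?_, fun _ => ?_, fun _ => ?_⟩ <;>
    · apply mul_left_cancel₀ (show (6 : ℤ) ≠ 0 by norm_num)
      linear_combination -h3 + 3 * h1 - 2 * h0
  -- Here `3i + 1 ≥ 3a + 4 > m₀`, and even `i - a - 1` is nonnegative, so every binomial equals its
  -- cubic polynomial.
  · have hmin : min (3 * i + 1) (3 * a + b) = 3 * a + b := by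
      have := (Finset.mem_Icc.mp hb).2
      omega
    have e2 := six_mul_binom3 (n := (i : ℤ) - a + 2) (by omega)
    have e1 := six_mul_binom3 (n := (i : ℤ) - a + 1) (by omega)
    have e0 := six_mul_binom3 (n := (i : ℤ) - a) (by omega)
    have e := six_mul_binom3 (n := (i : ℤ) - a - 1) (by omega)
    rw [hmin]
    refine ⟨?_, ?_, ?_⟩ <;> rintro rfl <;>
      apply mul_left_cancel₀ (show (6 : ℤ) ≠ 0 by norm_num) <;> push_cast
    · linear_combination -h3 + 3 * h1 - 2 * h0 + 3 * e2 - 6 * e1 + 3 * e0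
    · linear_combination -h3 + 3 * h1 - 2 * h0 + 2 * e2 - 3 * e1 + e
    · linear_combination -h3 + 3 * h1 - 2 * h0 + e2 - 3 * e0 + 2 * e
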